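/- Let $n\ge 0$, let $A,B:\mathbb{R}\to\mathbb{C}^{n\times n}$ be continuous and periodic with period $1$, and let $0\le\tau<1$. On the Banach space $C([-1,0];\mathbb{C}^n)$ with the maximum norm define, for $\mu\in\mathbb{C}$, the bounded operator $$[M_1(\mu)x](t)=\int_{-1}^t A(s)x(s)+B(s)\begin{cases}x(s-\tau)&\text{if } s\in[\tau-1,0],\\ \mu\,x(1+s-\tau)&\text{if } s\in[-1,\tau-1)\end{cases}\,ds .$$ For $v\in\mathbb{C}^n$ consider the initial-value problem in integral form, $x(t)=v+[M_1(\mu)x](t)$ for all $t\in[-1,0]$. At every $\mu$ where it has a unique solution $x\in C([-1,0];\mathbb{C}^n)$ for all $v$, the Szalai characteristic matrix $\Delta(\mu)\in\mathbb{C}^{n\times n}$ is defined by $\Delta(\mu)v=v-\mu x(0)$. A pole of an operator-valued function is of finite multiplicity if it is of finite order and all coefficients of the principal part of the Laurent expansion have finite rank. The algebraic multiplicity of $\mu_0$ for the family $I-M_1(\mu)$ is the supremum over $m\geq 1$ of the dimension of the space of tuples $(y_0,\dots,y_{m-1})$ in $C([-1,0];\mathbb{C}^n)$ with $[I-M_1(\mu)]\sum_{j<m}(\mu-\mu_0)^jy_j=O((\mu-\mu_0)^m)$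 as $\mu\to\mu_0$ (this is the total length of a canonical system of Jordan chains). 1. The function $\mu\mapsto[I-M_1(\mu)]^{-1}$ has at most finitely many poles in any bounded subset of $\mathbb{C}$. Every pole is of finite multiplicity, and its algebraic multiplicity for the family $I-M_1(\mu)$ is finite. If $\mu$ is not a pole, then $I-M_1(\mu)$ is invertible and $[I-M_1(\cdot)]^{-1}$ is analytic at $\mu$. 2. The same holds for $\Delta$. The initial-value problem is uniquely solvable for all $v$ at $\mu$ (so that $\Delta(\mu)$ is defined) if and only if $\mu$ is not a pole of $[I-M_1(\cdot)]^{-1}$; at every such $\mu$ the solution is $x=[I-M_1(\mu)]^{-1}v$ (with $v$ regarded as a constant function) and $\Delta$ is analytic. The function $\Delta$ has at most finitely many poles in any bounded subset of $\mathbb{C}$; each of them is a pole of $[I-M_1(\cdot)]^{-1}$ and is of finite multiplicity. At every $\mu\in\mathbb{C}$ that is not a pole of $\Delta$, the function $\Delta$ is analytic or has a removable singularity. -/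

import Mathlib

open Topology Filter
open scoped Matrix

/-! Periodic linear delay equations with a single delay, and their characteristic matrix. -/

namespace PeriodicDDE

noncomputable section

/-- The Banach space `C([-1,0]; ℂⁿ)` with the maximum norm. -/
abbrev Hist (n : ℕ) : Type := C(Set.Icc (-1 : ℝ) 0, Fin n → ℂ)

/-- The value `x(s)` for `s ∈ [-1,0]`; outside of `[-1,0]` the function is continued constantly
(these values never enter below when `0 ≤ τ < 1`). -/
def ext {n : ℕ} (x : Hist n) : ℝ → (Fin n → ℂ) :=
  Set.IccExtend (by norm_num : (-1 : ℝ) ≤ 0) x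

/-- The delayed argument: `x(s-τ)` if `s ∈ [τ-1,0]`, and `μ x(1+s-τ)` if `s ∈ [-1,τ-1)`. -/
def delayed {n : ℕ} (τ : ℝ) (μ : ℂ) (x : Hist n) (s : ℝ) : Fin n → ℂ :=
  if τ - 1 ≤ s then ext x (s - τ) else μ • ext x (1 + s - τ)

/-- The right-hand side `A(s) x(s) + B(s) {x(s-τ) or μ x(1+s-τ)}` of the delay equation. -/
def rhs {n : ℕ} (A B : C(ℝ, Matrix (Fin n) (Fin n) ℂ)) (τ : ℝ) (μ : ℂ) (x : Hist n) (s : ℝ) :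
    Fin n → ℂ :=
  A s *ᵥ ext x s + B s *ᵥ delayed τ μ x s

section aux

variable {n : ℕ} (A B : C(ℝ, Matrix (Fin n) (Fin n) ℂ)) (τ : ℝ) (μ : ℂ)

theorem ext_continuous (x : Hist n) : Continuous (ext x) :=
  x.continuous.Icc_extend'

theorem ext_add (x y : Hist n) (s : ℝ) : ext (x + y) s = ext x s + ext y s := rfl

theorem ext_smul (c : ℂ) (x : Hist n) (s : ℝ) : ext (c • x) s = c • ext x s := rfl

theorem norm_ext_le (x : Hist n) (s : ℝ) : ‖ext x s‖ ≤ ‖x‖ := x.norm_coe_le_norm _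

theorem delayed_add (x y : Hist n) (s : ℝ) :
    delayed τ μ (x + y) s = delayed τ μ x s + delayed τ μ y s := by
  unfold delayed; split_ifs <;> simp [ext_add]

theorem delayed_smul (c : ℂ) (x : Hist n) (s : ℝ) :
    delayed τ μ (c • x) s = c • delayed τ μ x s := by
  unfold delayed
  split_ifs
  · rw [ext_smul]
  · rw [ext_smul, smul_comm]

theorem rhs_add (x y : Hist n) (s : ℝ) :
    rhs A B τ μ (x + y) s = rhs A B τ μ x s + rhs A B τ μ y s := by
  simp only [rhs, ext_add, delayed_add, Matrix.mulVec_add]; abel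

theorem rhs_smul (c : ℂ) (x : Hist n) (s : ℝ) :
    rhs A B τ μ (c • x) s = c • rhs A B τ μ x s := by
  simp only [rhs, ext_smul, delayed_smul, Matrix.mulVec_smul, smul_add]

theorem rhs_eq_ite (x : Hist n) :
    rhs A B τ μ x = (Set.Ici (τ - 1)).piecewise
      (fun s => A s *ᵥ ext x s + B s *ᵥ ext x (s - τ))
      (fun s => A s *ᵥ ext x s + B s *ᵥ (μ • ext x (1 + s - τ))) := by
  funext s
  by_cases h : τ - 1 ≤ s <;> simp [rhs, delayed, Set.piecewise, h]

theorem rhs_intervalIntegrable (x : Hist n) (a b : ℝ) :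
    IntervalIntegrable (rhs A B τ μ x) MeasureTheory.volume a b := by
  have hx := ext_continuous x
  rw [rhs_eq_ite, intervalIntegrable_iff]
  refine MeasureTheory.Integrable.piecewise measurableSet_Ici ?_ ?_
  · refine MeasureTheory.IntegrableOn.integrable ?_ |>.restrict
    refine (intervalIntegrable_iff.1 (Continuous.intervalIntegrable ?_ a b))
    exact (A.continuous.matrix_mulVec hx).add (B.continuous.matrix_mulVec (by fun_prop))
  · refine MeasureTheory.IntegrableOn.integrable ?_ |>.restrict
    refine (intervalIntegrable_iff.1 (Continuous.intervalIntegrable ?_ a b))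
    exact (A.continuous.matrix_mulVec hx).add (B.continuous.matrix_mulVec (by fun_prop))

theorem exists_rhs_bound :
    ∃ K : ℝ, 0 ≤ K ∧ ∀ (x : Hist n), ∀ s ∈ Set.Icc (-1 : ℝ) 0, ‖rhs A B τ μ x s‖ ≤ K * ‖x‖ := by
  have key : ∀ D : C(ℝ, Matrix (Fin n) (Fin n) ℂ), ∃ K : ℝ, 0 ≤ K ∧
      ∀ s ∈ Set.Icc (-1 : ℝ) 0, ∀ w : Fin n → ℂ, ‖D s *ᵥ w‖ ≤ K * ‖w‖ := by
    intro D
    have hc : Continuous fun s => ∑ i, ∑ j, ‖D s i j‖ := by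
      refine continuous_finsetSum _ fun i _ => continuous_finsetSum _ fun j _ => ?_
      exact (D.continuous.matrix_elem i j).norm
    obtain ⟨K, hK⟩ := (isCompact_Icc (a := (-1 : ℝ)) (b := 0)).exists_bound_of_continuousOn
      hc.continuousOn
    have hK0 : 0 ≤ K := (norm_nonneg _).trans (hK 0 (by norm_num))
    refine ⟨K, hK0, fun s hs w => ?_⟩
    refine (pi_norm_le_iff_of_nonneg (by positivity)).2 fun i => ?_
    calc ‖(D s *ᵥ w) i‖ = ‖∑ j, D s i j * w j‖ := rfl
      _ ≤ ∑ j, ‖D s i j * w j‖ := norm_sum_le _ _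
      _ ≤ ∑ j, ‖D s i j‖ * ‖w‖ := by
          refine Finset.sum_le_sum fun j _ => ?_
          rw [norm_mul]
          exact mul_le_mul_of_nonneg_left (norm_le_pi_norm w j) (norm_nonneg _)
      _ = (∑ j, ‖D s i j‖) * ‖w‖ := (Finset.sum_mul _ _ _).symm
      _ ≤ (∑ i, ∑ j, ‖D s i j‖) * ‖w‖ := by
          refine mul_le_mul_of_nonneg_right ?_ (norm_nonneg _)
          exact Finset.single_le_sum (f := fun i => ∑ j, ‖D s i j‖)
            (fun i _ => Finset.sum_nonneg fun j _ => norm_nonneg _) (Finset.mem_univ i)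
      _ ≤ K * ‖w‖ := mul_le_mul_of_nonneg_right ((le_abs_self _).trans (hK s hs)) (norm_nonneg _)
  obtain ⟨KA, hA0, hA⟩ := key A
  obtain ⟨KB, hB0, hB⟩ := key B
  refine ⟨KA + KB * (1 + ‖μ‖), by positivity, fun x s hs => ?_⟩
  have h1 : ‖delayed τ μ x s‖ ≤ (1 + ‖μ‖) * ‖x‖ := by
    unfold delayed
    split_ifs
    · nlinarith [norm_ext_le x (s - τ), mul_nonneg (norm_nonneg μ) (norm_nonneg x)]
    · rw [norm_smul]
      nlinarith [mul_le_mul_of_nonneg_left (norm_ext_le x (1 + s - τ)) (norm_nonneg μ),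
        norm_nonneg x]
  calc ‖rhs A B τ μ x s‖ ≤ ‖A s *ᵥ ext x s‖ + ‖B s *ᵥ delayed τ μ x s‖ := norm_add_le _ _
    _ ≤ KA * ‖x‖ + KB * ((1 + ‖μ‖) * ‖x‖) := by
        refine add_le_add ((hA s hs _).trans ?_) ((hB s hs _).trans ?_)
        · exact mul_le_mul_of_nonneg_left (norm_ext_le x s) hA0
        · exact mul_le_mul_of_nonneg_left h1 hB0
    _ = (KA + KB * (1 + ‖μ‖)) * ‖x‖ := by ring

theorem integral_rhs_continuous (x : Hist n) :
    Continuous fun t : Set.Icc (-1 : ℝ) 0 => ∫ s in (-1 : ℝ)..t, rhs A B τ μ x s :=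
  (intervalIntegral.continuous_primitive (rhs_intervalIntegrable A B τ μ x) (-1)).comp
    continuous_subtype_val

end aux

/-- The linear map `x ↦ (t ↦ ∫_{-1}^t A(s)x(s) + B(s){…} ds)` on `C([-1,0]; ℂⁿ)`. -/
def M1Lin {n : ℕ} (A B : C(ℝ, Matrix (Fin n) (Fin n) ℂ)) (τ : ℝ) (μ : ℂ) :
    Hist n →ₗ[ℂ] Hist n where
  toFun x := ⟨fun t => ∫ s in (-1 : ℝ)..t, rhs A B τ μ x s, integral_rhs_continuous A B τ μ x⟩
  map_add' x y := by
    ext1 t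
    simp only [rhs_add, ContinuousMap.coe_mk, ContinuousMap.add_apply]
    exact intervalIntegral.integral_add (rhs_intervalIntegrable A B τ μ x _ _)
      (rhs_intervalIntegrable A B τ μ y _ _)
  map_smul' c x := by
    ext1 t
    simp only [rhs_smul, ContinuousMap.coe_mk, ContinuousMap.smul_apply, RingHom.id_apply]
    exact intervalIntegral.integral_smul c _

theorem M1Lin_bound {n : ℕ} (A B : C(ℝ, Matrix (Fin n) (Fin n) ℂ)) (τ : ℝ) (μ : ℂ) :
    ∃ K : ℝ, ∀ x : Hist n, ‖M1Lin A B τ μ x‖ ≤ K * ‖x‖ := by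
  obtain ⟨K, hK0, hK⟩ := exists_rhs_bound A B τ μ
  refine ⟨K, fun x => ?_⟩
  refine (ContinuousMap.norm_le _ (by positivity)).2 fun t => ?_
  have ht := t.2
  refine (intervalIntegral.norm_integral_le_of_norm_le_const (C := K * ‖x‖) ?_).trans ?_
  · intro s hs
    rw [Set.uIoc_of_le ht.1] at hs
    exact hK x s ⟨hs.1.le, hs.2.trans ht.2⟩
  · rw [abs_of_nonneg (by linarith [ht.1])]
    have : 0 ≤ K * ‖x‖ := by positivity
    nlinarith [ht.2]

/-- The bounded operator `M₁(μ)` on `C([-1,0]; ℂⁿ)`,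
`[M₁(μ)x](t) = ∫_{-1}^t A(s)x(s) + B(s){x(s-τ) or μ x(1+s-τ)} ds`. -/
def M1 {n : ℕ} (A B : C(ℝ, Matrix (Fin n) (Fin n) ℂ)) (τ : ℝ) (μ : ℂ) :
    Hist n →L[ℂ] Hist n :=
  (M1Lin A B τ μ).mkContinuousOfExistsBound (M1Lin_bound A B τ μ)

theorem M1_apply {n : ℕ} (A B : C(ℝ, Matrix (Fin n) (Fin n) ℂ)) (τ : ℝ) (μ : ℂ) (x : Hist n)
    (t : Set.Icc (-1 : ℝ) 0) : M1 A B τ μ x t = ∫ s in (-1 : ℝ)..t, rhs A B τ μ x s := rfl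

/-- The function `μ ↦ [I - M₁(μ)]⁻¹`, with values in the bounded operators on `C([-1,0]; ℂⁿ)`
(`Ring.inverse` is the two-sided inverse if there is one, and `0` otherwise). -/
def resolvent {n : ℕ} (A B : C(ℝ, Matrix (Fin n) (Fin n) ℂ)) (τ : ℝ) (μ : ℂ) :
    Hist n →L[ℂ] Hist n :=
  Ring.inverse (1 - M1 A B τ μ)

/-- `x` solves the initial-value problem with `x(-1) = v`, that is, it satisfies
`x(t) = v + [M₁(μ)x](t)` for all `t ∈ [-1,0]`. -/
def IsSolution {n : ℕ} (A B : C(ℝ, Matrix (Fin n) (Fin n) ℂ)) (τ : ℝ) (μ : ℂ) (v : Fin n → ℂ)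
    (x : Hist n) : Prop :=
  ∀ t : Set.Icc (-1 : ℝ) 0, x t = v + M1 A B τ μ x t

/-- At `μ` the initial-value problem has a unique solution for every initial value `v`. -/
def UniquelySolvable {n : ℕ} (A B : C(ℝ, Matrix (Fin n) (Fin n) ℂ)) (τ : ℝ) (μ : ℂ) : Prop :=
  ∀ v : Fin n → ℂ, ∃! x : Hist n, IsSolution A B τ μ v x

theorem IsSolution.add {n : ℕ} {A B : C(ℝ, Matrix (Fin n) (Fin n) ℂ)} {τ : ℝ} {μ : ℂ}
    {v w : Fin n → ℂ} {x y : Hist n} (hx : IsSolution A B τ μ v x) (hy : IsSolution A B τ μ w y) :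
    IsSolution A B τ μ (v + w) (x + y) := by
  intro t
  rw [map_add, ContinuousMap.add_apply, ContinuousMap.add_apply, hx t, hy t]
  abel

theorem IsSolution.smul {n : ℕ} {A B : C(ℝ, Matrix (Fin n) (Fin n) ℂ)} {τ : ℝ} {μ : ℂ}
    {v : Fin n → ℂ} {x : Hist n} (c : ℂ) (hx : IsSolution A B τ μ v x) :
    IsSolution A B τ μ (c • v) (c • x) := by
  intro t
  rw [map_smul, ContinuousMap.smul_apply, ContinuousMap.smul_apply, hx t, smul_add]

/-- The right end point `0` of the interval `[-1,0]`. -/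
def rightEnd : Set.Icc (-1 : ℝ) 0 := ⟨0, by norm_num⟩

open Classical in
/-- The characteristic matrix, as a linear map of `ℂⁿ`: `Δ(μ)v = v - μ x(0)`, where `x` is the
unique solution of the initial-value problem with `x(-1) = v`. It is defined where that problem is
uniquely solvable for all `v`; at other `μ` it has the placeholder value `0`. -/
def charMatrix {n : ℕ} (A B : C(ℝ, Matrix (Fin n) (Fin n) ℂ)) (τ : ℝ) (μ : ℂ) :
    (Fin n → ℂ) →L[ℂ] (Fin n → ℂ) :=
  if h : UniquelySolvable A B τ μ then
    LinearMap.toContinuousLinearMap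
      { toFun := fun v => v - μ • (h v).choose rightEnd
        map_add' := fun v w => by
          have e : (h (v + w)).choose = (h v).choose + (h w).choose :=
            (h (v + w)).unique (h (v + w)).choose_spec.1
              ((h v).choose_spec.1.add (h w).choose_spec.1)
          rw [e, ContinuousMap.add_apply, smul_add]
          abel
        map_smul' := fun c v => by
          have e : (h (c • v)).choose = c • (h v).choose :=
            (h (c • v)).unique (h (c • v)).choose_spec.1 ((h v).choose_spec.1.smul c)
          rw [e, ContinuousMap.smul_apply, RingHom.id_apply, smul_sub, smul_comm μ c] }
  else 0

end

end PeriodicDDE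

/-! Poles and multiplicities of operator-valued functions of a complex variable. -/

namespace OperatorFunction

noncomputable section

/-- `z` is a pole of `F`: near `z`, without `z`, `F(μ) = (μ-z)^{-p} G(μ)` with `p ≥ 1`, `G` analytic
at `z` and `G(z) ≠ 0`. The value `F(z)` plays no role. (Where `F` is not meromorphic, Mathlib's
order is `0`, so that an essential or non-isolated singularity is not a pole.) -/
def IsPole {E : Type*} [NormedAddCommGroup E] [NormedSpace ℂ E] (F : ℂ → E) (z : ℂ) : Prop :=
  meromorphicOrderAt F z < 0

/-- Near `z`, without `z`, the function `F` is the sum of finitely many terms `(μ-z)^{-j} C_j`,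
`j ≥ 1`, with operators `C_j` of finite rank, and of a function that is analytic at `z`. At a pole
this says that the pole has finite order and finite multiplicity: the principal part of `F` takes
values in a finite-dimensional space of vectors. -/
def HasFiniteRankPrincipalPart {X Y : Type*} [NormedAddCommGroup X] [NormedSpace ℂ X]
    [NormedAddCommGroup Y] [NormedSpace ℂ Y] (F : ℂ → X →L[ℂ] Y) (z : ℂ) : Prop :=
  ∃ (p : ℕ) (C : ℕ → X →L[ℂ] Y) (G : ℂ → X →L[ℂ] Y),
    (∀ j, FiniteDimensional ℂ (LinearMap.range (C j).toLinearMap)) ∧ AnalyticAt ℂ G z ∧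
      ∀ᶠ μ in 𝓝[≠] z, F μ = (∑ j ∈ Finset.Icc 1 p, ((μ - z) ^ j)⁻¹ • C j) + G μ

/-- The tuples `(y₀, …, y_{m-1})` with `∑_{j ≤ k} H^{(k-j)}(z)/(k-j)! y_j = 0` for `k < m`, that is,
`H(μ)[y₀ + (μ-z) y₁ + … + (μ-z)^{m-1} y_{m-1}] = O((μ-z)^m)` for a function `H` analytic at `z`:
the Jordan chains of length at most `m` of `H` at `z`, each preceded by zeros (`y₀ = 0` is allowed,
so that these tuples form a linear space). -/
def jordanChains {X : Type*} [NormedAddCommGroup X] [NormedSpace ℂ X] (H : ℂ → X →L[ℂ] X) (z : ℂ)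
    (m : ℕ) : Submodule ℂ (Fin m → X) where
  carrier := {y | ∀ k : Fin m, ∑ j ∈ Finset.Iic k,
    ((Nat.factorial ((k : ℕ) - j) : ℂ))⁻¹ • iteratedDeriv ((k : ℕ) - j) H z (y j) = 0}
  add_mem' {y w} hy hw := by
    intro k
    simp only [Pi.add_apply, map_add, smul_add, Finset.sum_add_distrib]
    rw [hy k, hw k, add_zero]
  zero_mem' := by
    intro k
    simp
  smul_mem' c y hy := by
    intro k
    simp only [Pi.smul_apply, map_smul, smul_comm _ c]
    rw [← Finset.smul_sum, hy k, smul_zero]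

/-- The algebraic multiplicity of `z` as an eigenvalue of `H(μ)x = 0`: the sum of the lengths of the
Jordan chains in a canonical system, which is `lim_m dim (jordanChains H z m)` (this dimension is
the sum of `min(m, κ_i)` over the chain lengths `κ_i`); `⊤` if it is infinite. -/
def algebraicMultiplicity {X : Type*} [NormedAddCommGroup X] [NormedSpace ℂ X]
    (H : ℂ → X →L[ℂ] X) (z : ℂ) : ℕ∞ :=
  ⨆ m : ℕ, Cardinal.toENat (Module.rank ℂ (jordanChains H z m))

end

end OperatorFunction

/-! The parameter enters `M1` affinely, so `1 - M1 A B τ μ` is a linear pencil `L - μ • K` with `L =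
1 - M1 A B τ 0` and `K = M1 A B τ 1 - M1 A B τ 0`. At `μ = 0` the term that reads the history ahead
of `s` disappears. What remains is a Volterra operator whose powers decay like `K ^ m / m!`, so `L`
is invertible (`isUnit_one_sub_M1_zero`). Integration makes the images Lipschitz, so the difference
`K` is a norm limit of operators of finite rank (`exists_finiteRank_approx`).

For such a pencil the analytic Fredholm theorem holds (`exists_det_of_approx`, `pencil_fredholm`).
On a given ball, up to a small perturbation of `L` that stays invertible, `K` has finite rank.
Inverting the pencil then amounts to inverting a matrix that depends analytically on `μ`. Its
determinant equals `1` at `μ = 0`, so its zeros are isolated, and the singular part of the inverse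
factors through a finite-dimensional space.

Jordan chains are read off from the resolvent: by uniqueness of the principal part, the last vector
of a chain determines the chain and lies in the range of the residue (`eq_of_principalPart`). The
multiplicity is thus at most the rank of the residue.

Finally `Δ(μ)` is the identity minus `μ` times the resolvent between two fixed operators
(`charMatrix_eq_resolventMatrix`), so it inherits analyticity and meromorphy, and can only have
poles where the resolvent has them. -/

namespace OperatorFunction

/-! ### Principal parts of finite rank. -/

section PrincipalPart

variable {X Y V : Type*} [NormedAddCommGroup X] [NormedSpace ℂ X] [NormedAddCommGroup Y]
  [NormedSpace ℂ Y] [NormedAddCommGroup V] [NormedSpace ℂ V]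

theorem analyticAt_dslope {E : Type*} [NormedAddCommGroup E] [NormedSpace ℂ E] {f : ℂ → E} {z : ℂ}
    (hf : AnalyticAt ℂ f z) : AnalyticAt ℂ (dslope f z) z := by
  obtain ⟨p, hp⟩ := hf
  exact ⟨_, hp.has_fpower_series_dslope_fslope⟩

theorem analyticAt_clm_comp {a : ℂ → V →L[ℂ] Y} {c : ℂ → X →L[ℂ] V} {z : ℂ}
    (ha : AnalyticAt ℂ a z) (hc : AnalyticAt ℂ c z) : AnalyticAt ℂ (fun μ => a μ ∘L c μ) z :=
  ((ContinuousLinearMap.compL ℂ X V Y).analyticAt_bilinear (a z, c z)).comp₂ ha hc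

theorem finiteDimensional_range_comp [FiniteDimensional ℂ V] (a : V →L[ℂ] Y) (c : X →L[ℂ] V) :
    FiniteDimensional ℂ (LinearMap.range (a ∘L c).toLinearMap) := by
  refine Submodule.finiteDimensional_of_le (S₂ := LinearMap.range a.toLinearMap) ?_
  rintro _ ⟨x, rfl⟩
  exact ⟨c x, rfl⟩

/-- Taylor expansion of order `p` at `z` with coefficients of finite rank. -/
def HasFiniteRankTaylor (p : ℕ) (z : ℂ) (g : ℂ → X →L[ℂ] Y) : Prop :=
  ∃ (C : ℕ → X →L[ℂ] Y) (G : ℂ → X →L[ℂ] Y),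
    (∀ j, FiniteDimensional ℂ (LinearMap.range (C j).toLinearMap)) ∧ AnalyticAt ℂ G z ∧
      ∀ μ, g μ = (∑ j ∈ Finset.range p, (μ - z) ^ j • C j) + (μ - z) ^ p • G μ

theorem HasFiniteRankTaylor.add {p : ℕ} {z : ℂ} {g h : ℂ → X →L[ℂ] Y}
    (hg : HasFiniteRankTaylor p z g) (hh : HasFiniteRankTaylor p z h) :
    HasFiniteRankTaylor p z (g + h) := by
  obtain ⟨C, G, hC, hG, e⟩ := hg
  obtain ⟨C', G', hC', hG', e'⟩ := hh
  refine ⟨fun j => C j + C' j, fun μ => G μ + G' μ, fun j => ?_, hG.add hG', fun μ => ?_⟩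
  · have := hC j
    have := hC' j
    refine Submodule.finiteDimensional_of_le
      (S₂ := LinearMap.range (C j).toLinearMap ⊔ LinearMap.range (C' j).toLinearMap) ?_
    rintro _ ⟨x, rfl⟩
    exact Submodule.add_mem_sup ⟨x, rfl⟩ ⟨x, rfl⟩
  · simp only [Pi.add_apply, e, e', smul_add, Finset.sum_add_distrib]
    abel

theorem HasFiniteRankTaylor.succ {p : ℕ} {z : ℂ} {g h : ℂ → X →L[ℂ] Y} {C₀ : X →L[ℂ] Y}
    (h₀ : FiniteDimensional ℂ (LinearMap.range C₀.toLinearMap))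
    (hh : HasFiniteRankTaylor p z h) (e : ∀ μ, g μ = C₀ + (μ - z) • h μ) :
    HasFiniteRankTaylor (p + 1) z g := by
  obtain ⟨C, G, hC, hG, e'⟩ := hh
  refine ⟨fun j => Nat.casesOn j C₀ C, G, fun j => ?_, hG, fun μ => ?_⟩
  · cases j
    exacts [h₀, hC _]
  · rw [e, e', Finset.sum_range_succ', smul_add, Finset.smul_sum]
    simp only [smul_smul, pow_succ', pow_zero, one_smul]
    change _ = _ + C₀ + _
    rw [add_comm _ C₀, add_assoc]

/-- Product rule for difference quotients: `a c - a(z) c(z) = (μ - z) (a' c + a(z) c')`, with `a'`,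
`c'` the slopes at `z`. Both new products again factor through `V`, so every coefficient has finite
rank. -/
theorem hasFiniteRankTaylor_comp [FiniteDimensional ℂ V] (p : ℕ) {a : ℂ → V →L[ℂ] Y}
    {c : ℂ → X →L[ℂ] V} {z : ℂ} (ha : AnalyticAt ℂ a z) (hc : AnalyticAt ℂ c z) :
    HasFiniteRankTaylor p z (fun μ => a μ ∘L c μ) := by
  induction p generalizing a c with
  | zero =>
    exact ⟨fun _ => 0, _, fun j => finiteDimensional_range_comp (0 : V →L[ℂ] Y) (0 : X →L[ℂ] V),
      analyticAt_clm_comp ha hc, fun μ => by simp⟩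
  | succ p ih =>
    refine ((ih (analyticAt_dslope ha) hc).add
      (ih (analyticAt_const (v := a z)) (analyticAt_dslope hc))).succ
      (finiteDimensional_range_comp (a z) (c z)) fun μ => ?_
    have h1 : (μ - z) • (dslope a z μ ∘L c μ) = a μ ∘L c μ - a z ∘L c μ := by
      rw [← ContinuousLinearMap.smul_comp, sub_smul_dslope, ContinuousLinearMap.sub_comp]
    have h2 : (μ - z) • (a z ∘L dslope c z μ) = a z ∘L c μ - a z ∘L c z := by
      rw [← ContinuousLinearMap.comp_smul, sub_smul_dslope, ContinuousLinearMap.comp_sub]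
    simp only [Pi.add_apply, smul_add, h1, h2]
    abel

theorem hasFiniteRankPrincipalPart_of_comp [FiniteDimensional ℂ V] {F D : ℂ → X →L[ℂ] Y} {z : ℂ}
    {a : ℂ → V →L[ℂ] Y} {c : ℂ → X →L[ℂ] V} (p : ℕ) (hD : AnalyticAt ℂ D z)
    (ha : AnalyticAt ℂ a z) (hc : AnalyticAt ℂ c z)
    (h : ∀ᶠ μ in 𝓝[≠] z, F μ = D μ + ((μ - z) ^ p)⁻¹ • (a μ ∘L c μ)) :
    HasFiniteRankPrincipalPart F z := by
  obtain ⟨C, G, hC, hG, e⟩ := hasFiniteRankTaylor_comp p ha hc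
  -- Division by `(μ - z) ^ p` turns the Taylor coefficient of order `p - k` into the coefficient of
  -- `(μ - z)⁻ᵏ`.
  refine ⟨p, fun k => C (p - k), fun μ => D μ + G μ, fun j => hC _, hD.add hG, ?_⟩
  filter_upwards [h, self_mem_nhdsWithin] with μ hμ hne
  have hne : μ - z ≠ 0 := sub_ne_zero.2 hne
  have hsum : ∑ j ∈ Finset.Icc 1 p, ((μ - z) ^ j)⁻¹ • C (p - j)
      = ∑ j ∈ Finset.range p, ((μ - z) ^ p)⁻¹ • (μ - z) ^ j • C j := by
    refine Finset.sum_nbij' (fun j => p - j) (fun j => p - j) ?_ ?_ ?_ ?_ ?_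
    · intro j hj
      simp only [Finset.mem_Icc, Finset.mem_range] at *
      omega
    · intro j hj
      simp only [Finset.mem_Icc, Finset.mem_range] at *
      omega
    · intro j hj
      simp only [Finset.mem_Icc] at hj
      omega
    · intro j hj
      simp only [Finset.mem_range] at hj
      omega
    · intro j hj
      simp only [Finset.mem_Icc] at hj
      rw [smul_smul, pow_sub₀ _ hne hj.2, ← mul_assoc, inv_mul_cancel₀ (pow_ne_zero _ hne), one_mul]
  have e := e μ
  beta_reduce at e
  rw [hμ, e, hsum, smul_add, Finset.smul_sum, smul_smul, inv_mul_cancel₀ (pow_ne_zero _ hne),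
    one_smul]
  abel

theorem HasFiniteRankPrincipalPart.meromorphicAt {F : ℂ → X →L[ℂ] Y} {z : ℂ}
    (h : HasFiniteRankPrincipalPart F z) : MeromorphicAt F z := by
  obtain ⟨p, C, G, -, hG, e⟩ := h
  refine MeromorphicAt.congr (f := fun μ => (∑ j ∈ Finset.Icc 1 p, ((μ - z) ^ j)⁻¹ • C j) + G μ)
    ?_ (e.mono fun _ h => h.symm)
  refine MeromorphicAt.fun_add (MeromorphicAt.fun_sum fun j _ => ?_) hG.meromorphicAt
  exact MeromorphicAt.fun_smul (MeromorphicAt.fun_inv (by fun_prop)) (MeromorphicAt.const _ _)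

/-- A meromorphic function with values in the operators into a finite-dimensional space has
principal parts of finite rank. -/
theorem hasFiniteRankPrincipalPart_of_meromorphicAt [FiniteDimensional ℂ Y] {F : ℂ → X →L[ℂ] Y}
    {z : ℂ} (h : MeromorphicAt F z) : HasFiniteRankPrincipalPart F z := by
  obtain ⟨p, hp⟩ := h
  -- The factorization is through `Y` itself, by the identity.
  refine hasFiniteRankPrincipalPart_of_comp (V := Y) (D := fun _ => 0)
    (a := fun _ => ContinuousLinearMap.id ℂ Y) p analyticAt_const analyticAt_const hp ?_
  filter_upwards [self_mem_nhdsWithin] with μ hne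
  rw [ContinuousLinearMap.id_comp, smul_smul,
    inv_mul_cancel₀ (pow_ne_zero _ (sub_ne_zero.2 hne)), one_smul, zero_add]

theorem exists_analyticAt_of_not_isPole {E : Type*} [NormedAddCommGroup E] [NormedSpace ℂ E]
    {F : ℂ → E} {z : ℂ} (hF : MeromorphicAt F z) (h : ¬ IsPole F z) :
    ∃ G : ℂ → E, AnalyticAt ℂ G z ∧ F =ᶠ[𝓝[≠] z] G :=
  hF.meromorphicOrderAt_nonneg_iff.1 (not_lt.1 h)

theorem not_isPole_of_analyticAt {E : Type*} [NormedAddCommGroup E] [NormedSpace ℂ E]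
    {F : ℂ → E} {z : ℂ} (hF : AnalyticAt ℂ F z) : ¬ IsPole F z :=
  not_lt.2 hF.meromorphicOrderAt_nonneg

/-- Uniqueness of the principal part. -/
theorem principalPart_eq_zero {E : Type*} [NormedAddCommGroup E] [NormedSpace ℂ E] {z : ℂ} {q : ℕ}
    {c : ℕ → E} {g : ℂ → E} (hg : ContinuousAt g z)
    (h : ∀ᶠ μ in 𝓝[≠] z, ∑ k ∈ Finset.Icc 1 q, ((μ - z) ^ k)⁻¹ • c k = g μ) :
    ∀ k ∈ Finset.Icc 1 q, c k = 0 := by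
  induction q with
  | zero => simp
  | succ q ih =>
    -- Multiplied by `(μ - z) ^ (q + 1)`, the sum tends to `c (q + 1)` and the right-hand side to
    -- `0`.
    have top : c (q + 1) = 0 := by
      have h1 : Tendsto (fun μ => ∑ k ∈ Finset.Icc 1 (q + 1), (μ - z) ^ (q + 1 - k) • c k)
          (𝓝[≠] z) (𝓝 (∑ k ∈ Finset.Icc 1 (q + 1), (z - z) ^ (q + 1 - k) • c k)) :=
        Tendsto.mono_left (Continuous.tendsto (by fun_prop) z) nhdsWithin_le_nhds
      have h2 : Tendsto (fun μ => (μ - z) ^ (q + 1) • g μ) (𝓝[≠] z)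
          (𝓝 ((z - z) ^ (q + 1) • g z)) :=
        Tendsto.mono_left
          (ContinuousAt.tendsto (f := fun μ => (μ - z) ^ (q + 1) • g μ) (by fun_prop))
          nhdsWithin_le_nhds
      have h3 := tendsto_nhds_unique_of_eventuallyEq h1 h2 (by
        filter_upwards [h, self_mem_nhdsWithin] with μ hμ hne
        have hne : μ - z ≠ 0 := sub_ne_zero.2 hne
        rw [← hμ, Finset.smul_sum]
        refine Finset.sum_congr rfl fun k hk => ?_
        rw [smul_smul, pow_sub₀ _ hne (Finset.mem_Icc.1 hk).2])
      rw [sub_self, zero_pow (by omega), zero_smul, Finset.sum_eq_single (q + 1)] at h3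
      · simpa using h3
      · intro k hk hkq
        have := (Finset.mem_Icc.1 hk).2
        rw [zero_pow (by omega), zero_smul]
      · simp
    have ih' := ih (by
      filter_upwards [h] with μ hμ
      rwa [Finset.sum_Icc_succ_top (by omega), top, smul_zero, add_zero] at hμ)
    intro k hk
    rcases (Finset.mem_Icc.1 hk).2.eq_or_lt with rfl | hlt
    · exact top
    · exact ih' k (Finset.mem_Icc.2 ⟨(Finset.mem_Icc.1 hk).1, by omega⟩)

end PrincipalPart

/-! ### Poles of inverses. -/

section Inverse

variable {R : Type*} [NormedRing R] [NormedAlgebra ℂ R] [CompleteSpace R]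

theorem analyticAt_ringInverse {H : ℂ → R} {z : ℂ} (hH : AnalyticAt ℂ H z) (h : IsUnit (H z)) :
    AnalyticAt ℂ (fun μ => Ring.inverse (H μ)) z := by
  obtain ⟨u, hu⟩ := h
  have := analyticAt_inverse (𝕜 := ℂ) u
  rw [hu] at this
  exact this.comp hH

/-- If the inverse of an analytic function exists near `z` and is meromorphic at `z`, then it has a
pole at `z` exactly if it does not exist at `z`. -/
theorem isPole_ringInverse_iff {H : ℂ → R} {z : ℂ} (hH : AnalyticAt ℂ H z)
    (hu : ∀ᶠ μ in 𝓝[≠] z, IsUnit (H μ)) (hm : MeromorphicAt (fun μ => Ring.inverse (H μ)) z) :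
    IsPole (fun μ => Ring.inverse (H μ)) z ↔ ¬ IsUnit (H z) := by
  refine ⟨fun h h' => not_isPole_of_analyticAt (analyticAt_ringInverse hH h') h, fun h => ?_⟩
  by_contra hp
  refine h ?_
  -- Without a pole the inverse extends continuously to `z`, and both inverse relations pass to the
  -- limit.
  obtain ⟨G, hG, e⟩ := exists_analyticAt_of_not_isPole hm hp
  have hc : Tendsto H (𝓝[≠] z) (𝓝 (H z)) := hH.continuousAt.tendsto.mono_left nhdsWithin_le_nhds
  have gc : Tendsto G (𝓝[≠] z) (𝓝 (G z)) := hG.continuousAt.tendsto.mono_left nhdsWithin_le_nhds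
  have h1 : H z * G z = 1 := by
    refine tendsto_nhds_unique_of_eventuallyEq (hc.mul gc) tendsto_const_nhds ?_
    filter_upwards [hu, e] with μ hμ hμ'
    rw [← hμ', Ring.mul_inverse_cancel _ hμ]
  have h2 : G z * H z = 1 := by
    refine tendsto_nhds_unique_of_eventuallyEq (gc.mul hc) tendsto_const_nhds ?_
    filter_upwards [hu, e] with μ hμ hμ'
    rw [← hμ', Ring.inverse_mul_cancel _ hμ]
  exact ⟨⟨_, _, h1, h2⟩, rfl⟩

end Inverse

/-! ### Linear pencils and their Jordan chains. -/

section Pencil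

variable {X : Type*} [NormedAddCommGroup X] [NormedSpace ℂ X] (L K : X →L[ℂ] X)

theorem hasDerivAt_pencil (z : ℂ) : HasDerivAt (fun μ : ℂ => L - μ • K) (-K) z := by
  simpa using ((hasDerivAt_id z).smul_const K).const_sub L

theorem analyticAt_pencil (z : ℂ) : AnalyticAt ℂ (fun μ : ℂ => L - μ • K) z :=
  analyticAt_const.sub (analyticAt_id.smul analyticAt_const)

theorem deriv_pencil : deriv (fun μ : ℂ => L - μ • K) = fun _ => -K :=
  funext fun z => (hasDerivAt_pencil L K z).deriv

theorem iteratedDeriv_pencil_add_two (i : ℕ) (z : ℂ) :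
    iteratedDeriv (i + 2) (fun μ : ℂ => L - μ • K) z = 0 := by
  rw [iteratedDeriv_succ', deriv_pencil, iteratedDeriv_succ', deriv_const', iteratedDeriv_const]
  split_ifs <;> rfl

variable {L K} {z : ℂ} {m : ℕ} {y : Fin m → X}

theorem jordanChains_pencil_zero (hy : y ∈ jordanChains (fun μ => L - μ • K) z m) (h : 0 < m) :
    (L - z • K) (y ⟨0, h⟩) = 0 := by
  have := hy ⟨0, h⟩
  rw [Finset.sum_eq_single (⟨0, h⟩ : Fin m)] at this
  · simpa using this
  · intro j hj hne
    exact absurd (le_antisymm (Finset.mem_Iic.1 hj) (Fin.mk_le_of_le_val (Nat.zero_le _))) hne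
  · intro h'
    exact absurd (Finset.mem_Iic.2 le_rfl) h'

/-- Derivatives of order two and higher vanish, so the chain condition becomes a two-term recursion.
-/
theorem jordanChains_pencil_succ (hy : y ∈ jordanChains (fun μ => L - μ • K) z m) {i : ℕ}
    (h : i + 1 < m) : (L - z • K) (y ⟨i + 1, h⟩) = K (y ⟨i, by omega⟩) := by
  have := hy ⟨i + 1, h⟩
  rw [← Finset.sum_subset (s₁ := {⟨i, by omega⟩, ⟨i + 1, h⟩}), Finset.sum_pair] at this
  · simp only [add_tsub_cancel_left, Nat.factorial_one, Nat.cast_one, inv_one, iteratedDeriv_one,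
      one_smul, tsub_self, Nat.factorial_zero, iteratedDeriv_zero, deriv_pencil,
      neg_apply] at this
    exact (neg_add_eq_zero.1 this).symm
  · simp
  · intro j hj
    simp only [Finset.mem_insert, Finset.mem_singleton, Finset.mem_Iic, Fin.ext_iff,
      Fin.le_def] at *
    omega
  · intro j hj hj'
    simp only [Finset.mem_insert, Finset.mem_singleton, Finset.mem_Iic, Fin.ext_iff,
      Fin.le_def] at hj hj'
    obtain ⟨l, hl⟩ : ∃ l, i + 1 - (j : ℕ) = l + 2 := ⟨i + 1 - j - 2, by omega⟩
    simp only [hl, iteratedDeriv_pencil_add_two, zero_apply, smul_zero]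

/-- Since `L - μ K = (L - z K) - (μ - z) K`, the chain relations telescope and only the top term
survives. -/
theorem pencil_apply_sum {Y : ℕ → X} {r : ℕ} (h0 : (L - z • K) (Y 0) = 0)
    (h : ∀ i < r, (L - z • K) (Y (i + 1)) = K (Y i)) (μ : ℂ) :
    (L - μ • K) (∑ j ∈ Finset.range (r + 1), (μ - z) ^ j • Y j)
      = -((μ - z) ^ (r + 1) • K (Y r)) := by
  have key : ∀ x, (L - μ • K) x = (L - z • K) x - (μ - z) • K x := by
    intro x
    simp only [sub_apply, smul_apply, sub_smul]
    abel
  induction r with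
  | zero => simp [key, h0]
  | succ r ih =>
    rw [Finset.sum_range_succ, map_add, ih fun i hi => h i (by omega), map_smul, key,
      h r (by omega), smul_sub, smul_smul, ← pow_succ]
    abel

/-- The last vector of a Jordan chain determines the chain, and it lies in the range of the first
coefficient of the principal part of the resolvent. -/
theorem eq_of_principalPart {p : ℕ} {C : ℕ → X →L[ℂ] X} {G : ℂ → X →L[ℂ] X}
    (hG : AnalyticAt ℂ G z) (hu : ∀ᶠ μ in 𝓝[≠] z, IsUnit (L - μ • K))
    (e : ∀ᶠ μ in 𝓝[≠] z, Ring.inverse (L - μ • K)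
      = (∑ j ∈ Finset.Icc 1 p, ((μ - z) ^ j)⁻¹ • C j) + G μ)
    {Y : ℕ → X} {r : ℕ} (h0 : (L - z • K) (Y 0) = 0)
    (h : ∀ i < r, (L - z • K) (Y (i + 1)) = K (Y i)) {k : ℕ} (hk : k ∈ Finset.Icc 1 (r + 1)) :
    Y (r + 1 - k) + (if k ≤ p then C k (K (Y r)) else 0) = 0 := by
  set w := K (Y r)
  -- The coefficient of `(μ - z)⁻ᵏ` in the chain polynomial divided by `(μ - z) ^ (r + 1)`, plus
  -- that of the resolvent applied to `w`. By `pencil_apply_sum` these two functions are negatives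
  -- of each other. Both lists are padded with zeros to a common length.
  let c : ℕ → X := fun k =>
    (if k ≤ r + 1 then Y (r + 1 - k) else 0) + (if k ≤ p then C k w else 0)
  have hsum : ∀ (N : ℕ) (f : ℕ → X), N ≤ max (r + 1) p →
      ∑ k ∈ Finset.Icc 1 (max (r + 1) p), (if k ≤ N then f k else 0)
        = ∑ k ∈ Finset.Icc 1 N, f k := by
    intro N f hN
    rw [← Finset.sum_filter]
    refine Finset.sum_congr ?_ fun _ _ => rfl
    ext k
    simp only [Finset.mem_filter, Finset.mem_Icc]
    omega
  have hc := principalPart_eq_zero (z := z) (q := max (r + 1) p) (c := c) (g := fun μ => -(G μ w))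
    (by have := hG.continuousAt; fun_prop) (by
      filter_upwards [hu, e, self_mem_nhdsWithin] with μ hμ eμ hne
      have hne : μ - z ≠ 0 := sub_ne_zero.2 hne
      have h1 := congrArg (fun x => Ring.inverse (L - μ • K) x) (pencil_apply_sum h0 h μ)
      beta_reduce at h1
      rw [← mul_apply_eq_comp, Ring.inverse_mul_cancel _ hμ,
        one_apply_eq_self, map_neg, map_smul, eμ] at h1
      have h2 : ∑ k ∈ Finset.Icc 1 (r + 1), ((μ - z) ^ k)⁻¹ • Y (r + 1 - k)
          = ((μ - z) ^ (r + 1))⁻¹ • ∑ j ∈ Finset.range (r + 1), (μ - z) ^ j • Y j := by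
        rw [Finset.smul_sum]
        refine Finset.sum_nbij' (fun j => r + 1 - j) (fun j => r + 1 - j) ?_ ?_ ?_ ?_ ?_
        · intro j hj
          simp only [Finset.mem_Icc, Finset.mem_range] at *
          omega
        · intro j hj
          simp only [Finset.mem_Icc, Finset.mem_range] at *
          omega
        · intro j hj
          simp only [Finset.mem_Icc] at hj
          omega
        · intro j hj
          simp only [Finset.mem_range] at hj
          omega
        · intro j hj
          simp only [Finset.mem_Icc] at hj
          rw [smul_smul, pow_sub₀ _ hne hj.2, ← mul_assoc, inv_mul_cancel₀ (pow_ne_zero _ hne),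
            one_mul]
      rw [h1, smul_neg, smul_smul, inv_mul_cancel₀ (pow_ne_zero _ hne), one_smul] at h2
      simp only [c, smul_add, smul_ite, smul_zero, Finset.sum_add_distrib]
      rw [hsum _ _ (le_max_left _ _), hsum _ _ (le_max_right _ _), h2]
      simp only [add_apply, sum_apply,
        smul_apply]
      abel)
  have hkr := Finset.mem_Icc.1 hk
  have := hc k (Finset.mem_Icc.2 ⟨hkr.1, hkr.2.trans (le_max_left _ _)⟩)
  simpa only [c, if_pos hkr.2] using this

/-- The map from a chain to its last vector is injective with values in the range of `C 1`, which
bounds the dimension independently of `m`. -/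
theorem algebraicMultiplicity_pencil_lt_top (hu : ∀ᶠ μ in 𝓝[≠] z, IsUnit (L - μ • K))
    (hR : HasFiniteRankPrincipalPart (fun μ => Ring.inverse (L - μ • K)) z) :
    algebraicMultiplicity (fun μ => L - μ • K) z < ⊤ := by
  obtain ⟨p, C, G, hC, hG, e⟩ := hR
  have := hC 1
  refine lt_of_le_of_lt (b := Cardinal.toENat (Module.rank ℂ (LinearMap.range (C 1).toLinearMap)))
    (iSup_le fun m => ?_) ?_
  · refine OrderHomClass.mono Cardinal.toENat ?_
    cases m with
    | zero => exact (rank_subsingleton' ℂ _).trans_le zero_le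
    | succ r =>
      have key : ∀ y ∈ jordanChains (fun μ => L - μ • K) z (r + 1), ∀ k ∈ Finset.Icc 1 (r + 1),
          y (Fin.ofNat (r + 1) (r + 1 - k))
            + (if k ≤ p then C k (K (y (Fin.last r))) else 0) = 0 := by
        intro y hy k hk
        -- `Fin.ofNat` reduces modulo `r + 1`, but only indices up to `r` are used.
        have h := eq_of_principalPart (Y := fun i => y (Fin.ofNat (r + 1) i)) (r := r) hG hu e
          (by simpa using jordanChains_pencil_zero hy (Nat.succ_pos r))
          (fun i hi => by
            have := jordanChains_pencil_succ hy (Nat.succ_lt_succ hi)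
            convert this using 3 <;> simp [Fin.ext_iff] <;> omega) hk
        have hl : Fin.ofNat (r + 1) r = Fin.last r := by simp
        rwa [hl] at h
      let f : jordanChains (fun μ => L - μ • K) z (r + 1) →ₗ[ℂ] X :=
        LinearMap.proj (Fin.last r) ∘ₗ Submodule.subtype _
      have hf : ∀ y, f y ∈ LinearMap.range (C 1).toLinearMap := by
        intro y
        have h := key y.1 y.2 1 (by simp)
        have hl : Fin.ofNat (r + 1) (r + 1 - 1) = Fin.last r := by simp
        rw [hl] at h
        change y.1 (Fin.last r) ∈ _
        rw [eq_neg_of_add_eq_zero_left h]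
        split_ifs
        · exact neg_mem ⟨_, rfl⟩
        · simp
      refine LinearMap.rank_le_of_injective (f.codRestrict _ hf) ?_
      rw [← LinearMap.ker_eq_bot, LinearMap.ker_codRestrict, LinearMap.ker_eq_bot']
      intro y hy
      change y.1 (Fin.last r) = 0 at hy
      ext i
      -- This choice of `k` singles out the entry `y i`.
      have h := key y.1 y.2 (r + 1 - i) (by simp; omega)
      have hl : Fin.ofNat (r + 1) (r + 1 - (r + 1 - i)) = i := by
        simp only [Fin.ofNat_eq_cast, Fin.ext_iff, Fin.val_natCast]
        rw [Nat.mod_eq_of_lt] <;> omega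
      rw [hl, hy, map_zero, map_zero, ite_self, add_zero] at h
      exact h
  · rw [← Module.finrank_eq_rank]
    simpa using Module.rank_lt_aleph0 ℂ _

end Pencil

/-! ### Analytic Fredholm theorem for a linear pencil. -/

section Fredholm

variable {X : Type*} [NormedAddCommGroup X] [NormedSpace ℂ X]

/-- Woodbury identity: applying `φ E` to `(D - ι φ) x = y` leaves the equation `(1 - φ E ι) φ x = φ
E y` in `V`, and `φ x` gives back `x = E y + E ι φ x`. -/
theorem mul_eq_one_of_comp {V : Type*} [NormedAddCommGroup V] [NormedSpace ℂ V]
    {D E : X →L[ℂ] X} (hDE : D * E = 1) (hED : E * D = 1) {ι : V →L[ℂ] X} {φ : X →L[ℂ] V}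
    {W : V →L[ℂ] V} (h1 : (1 - φ ∘L E ∘L ι) * W = 1) (h2 : W * (1 - φ ∘L E ∘L ι) = 1) :
    (D - ι ∘L φ) * (E + E ∘L ι ∘L W ∘L φ ∘L E) = 1 ∧
      (E + E ∘L ι ∘L W ∘L φ ∘L E) * (D - ι ∘L φ) = 1 := by
  have a1 : ∀ x, D (E x) = x := fun x => DFunLike.congr_fun hDE x
  have a2 : ∀ x, E (D x) = x := fun x => DFunLike.congr_fun hED x
  have b1 : ∀ v, W v - φ (E (ι (W v))) = v := fun v => DFunLike.congr_fun h1 v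
  have b2 : ∀ v, W (v - φ (E (ι v))) = v := fun v => DFunLike.congr_fun h2 v
  constructor
  · ext x
    change D (E x + E (ι (W (φ (E x))))) - ι (φ (E x + E (ι (W (φ (E x)))))) = x
    have h := congrArg ι (b1 (φ (E x)))
    rw [map_sub] at h
    rw [map_add, a1, a1, map_add, map_add, ← h]
    abel
  · ext x
    change E (D x - ι (φ x)) + E (ι (W (φ (E (D x - ι (φ x)))))) = x
    rw [map_sub, a2, map_sub, b2]
    abel

/-- A matrix as a bounded operator. -/
noncomputable def matrixCLM (N : ℕ) :
    (Fin N → Fin N → ℂ) →L[ℂ] ((Fin N → ℂ) →L[ℂ] (Fin N → ℂ)) :=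
  LinearMap.toContinuousLinearMap (LinearMap.toContinuousLinearMap.toLinearMap ∘ₗ
    Matrix.toLin'.toLinearMap ∘ₗ (Matrix.ofLinearEquiv ℂ).toLinearMap)

theorem matrix_det_analyticAt {N : ℕ} {P : ℂ → Matrix (Fin N) (Fin N) ℂ} {z : ℂ}
    (hP : ∀ i j, AnalyticAt ℂ (fun μ => P μ i j) z) : AnalyticAt ℂ (fun μ => (P μ).det) z := by
  simp only [Matrix.det_apply']
  refine Finset.analyticAt_fun_sum _ fun σ _ => analyticAt_const.mul ?_
  exact Finset.analyticAt_fun_prod _ fun i _ => hP _ _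

theorem matrix_adjugate_analyticAt {N : ℕ} {P : ℂ → Matrix (Fin N) (Fin N) ℂ} {z : ℂ}
    (hP : ∀ i j, AnalyticAt ℂ (fun μ => P μ i j) z) (i j : Fin N) :
    AnalyticAt ℂ (fun μ => (P μ).adjugate i j) z := by
  simp only [Matrix.adjugate_apply]
  refine matrix_det_analyticAt fun k l => ?_
  simp only [Matrix.updateRow_apply]
  split_ifs
  exacts [analyticAt_const, hP _ _]

/-- An operator of finite rank factors through a coordinate space. -/
theorem exists_factorization_of_finiteRank {Y : Type*} [NormedAddCommGroup Y] [NormedSpace ℂ Y]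
    (F : X →L[ℂ] Y) [FiniteDimensional ℂ (LinearMap.range F.toLinearMap)] :
    ∃ (N : ℕ) (φ : X →L[ℂ] (Fin N → ℂ)) (ι : (Fin N → ℂ) →L[ℂ] Y), F = ι ∘L φ := by
  let b := (Module.finBasis ℂ (LinearMap.range F.toLinearMap)).equivFunL
  refine ⟨_, b.toContinuousLinearMap ∘L F.codRestrict (LinearMap.range F.toLinearMap) fun x => ⟨x, rfl⟩,
    (LinearMap.range F.toLinearMap).subtypeL ∘L b.symm.toContinuousLinearMap, ?_⟩
  ext x
  exact (congrArg Subtype.val (b.symm_apply_apply ⟨F x, x, rfl⟩)).symm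

variable [CompleteSpace X]

/-- Invertibility of the pencil `L - μ K` near `z` reduces to the nonvanishing of an analytic
determinant. -/
theorem exists_det_of_approx {L K : X →L[ℂ] X} (hL : IsUnit L)
    (hK : ∀ ε : ℝ, 0 < ε → ∃ F : X →L[ℂ] X,
      FiniteDimensional ℂ (LinearMap.range F.toLinearMap) ∧ ‖K - F‖ < ε) (r : ℝ) :
    ∃ (N : ℕ) (E : ℂ → X →L[ℂ] X) (ι : (Fin N → ℂ) →L[ℂ] X) (φ : X →L[ℂ] (Fin N → ℂ))
      (J : ℂ → (Fin N → ℂ) →L[ℂ] (Fin N → ℂ)) (d : ℂ → ℂ), d 0 = 1 ∧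
      (∀ z ∈ Metric.ball (0 : ℂ) r, AnalyticAt ℂ E z ∧ AnalyticAt ℂ J z ∧ AnalyticAt ℂ d z ∧
        (Function.Injective (L - z • K) → d z ≠ 0) ∧
        (d z ≠ 0 → IsUnit (L - z • K) ∧
          Ring.inverse (L - z • K)
            = E z + E z ∘L (z • ι) ∘L ((d z)⁻¹ • J z) ∘L φ ∘L E z)) := by
  obtain ⟨u, rfl⟩ := hL
  set M := ‖((u⁻¹ : (X →L[ℂ] X)ˣ) : X →L[ℂ] X)‖
  have hM : 0 ≤ M := norm_nonneg _
  have hr : 0 < |r| + 1 := by positivity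
  -- With this tolerance the Neumann series for `1 - z u⁻¹ (K - F)` converges whenever `‖z‖ < |r| +
  -- 1`. The added ones keep the constant positive for every `r` and `M`.
  obtain ⟨F, hF, hKF⟩ := hK (((|r| + 1) * (M + 1))⁻¹) (by positivity)
  obtain ⟨N, φ, ι, rfl⟩ := exists_factorization_of_finiteRank F
  set S := K - ι ∘L φ
  have hD : ∀ z ∈ Metric.ball (0 : ℂ) r, IsUnit ((u : X →L[ℂ] X) - z • S) := by
    intro z hz
    have hz' : ‖z‖ < |r| + 1 := by
      have := mem_ball_zero_iff.1 hz
      linarith [le_abs_self r]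
    have e : (u : X →L[ℂ] X) - z • S = u * (1 - z • ((u⁻¹ : (X →L[ℂ] X)ˣ) * S)) := by
      rw [mul_sub, mul_one, mul_smul_comm, ← mul_assoc, Units.mul_inv, one_mul]
    rw [e]
    refine u.isUnit.mul (isUnit_one_sub_of_norm_lt_one ?_)
    calc ‖z • (((u⁻¹ : (X →L[ℂ] X)ˣ) : X →L[ℂ] X) * S)‖ ≤ ‖z‖ * (M * ‖S‖) := by
          rw [norm_smul]
          gcongr
          exact norm_mul_le _ _
      _ ≤ (|r| + 1) * (M * ((|r| + 1) * (M + 1))⁻¹) := by gcongr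
      _ = M / (M + 1) := by field_simp
      _ < 1 := by rw [div_lt_one (by positivity)]; linarith
  set E : ℂ → X →L[ℂ] X := fun z => Ring.inverse ((u : X →L[ℂ] X) - z • S)
  have hE : ∀ z ∈ Metric.ball (0 : ℂ) r, AnalyticAt ℂ E z := fun z hz =>
    analyticAt_ringInverse (analyticAt_pencil _ _ z) (hD z hz)
  set W : ℂ → (Fin N → ℂ) →L[ℂ] (Fin N → ℂ) := fun z => 1 - φ ∘L E z ∘L (z • ι)
  have hW : ∀ z ∈ Metric.ball (0 : ℂ) r, AnalyticAt ℂ W z := fun z hz =>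
    analyticAt_const.sub (analyticAt_clm_comp analyticAt_const
      (analyticAt_clm_comp (hE z hz) (analyticAt_id.smul analyticAt_const)))
  set P : ℂ → Matrix (Fin N) (Fin N) ℂ := fun z => LinearMap.toMatrix' (W z).toLinearMap
  have hP : ∀ z ∈ Metric.ball (0 : ℂ) r, ∀ i j, AnalyticAt ℂ (fun μ => P μ i j) z := by
    intro z hz i j
    exact ((ContinuousLinearMap.proj (R := ℂ) (φ := fun _ : Fin N => ℂ) i ∘L
      ContinuousLinearMap.apply ℂ (Fin N → ℂ) (Pi.single j (1 : ℂ))).analyticAt (W z)).comp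
        (hW z hz)
  have hPW : ∀ z v, P z *ᵥ v = W z v := by
    intro z v
    rw [← Matrix.toLin'_apply, Matrix.toLin'_toMatrix']
    rfl
  refine ⟨N, E, ι, φ, fun z => matrixCLM N (P z).adjugate, fun z => (P z).det, ?_, ?_⟩
  · have : W 0 = 1 := by
      ext1 v
      simp [W]
    simp only [P, this]
    exact (congrArg Matrix.det LinearMap.toMatrix'_one).trans Matrix.det_one
  intro z hz
  have hDE : ((u : X →L[ℂ] X) - z • S) * E z = 1 := Ring.mul_inverse_cancel _ (hD z hz)
  have hED : E z * ((u : X →L[ℂ] X) - z • S) = 1 := Ring.inverse_mul_cancel _ (hD z hz)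
  have hDK : (u : X →L[ℂ] X) - z • K = ((u : X →L[ℂ] X) - z • S) - (z • ι) ∘L φ := by
    rw [ContinuousLinearMap.smul_comp]
    simp only [S, smul_sub]
    abel
  refine ⟨hE z hz, ?_, matrix_det_analyticAt (hP z hz), ?_, ?_⟩
  · refine ((matrixCLM N).analyticAt _).comp ?_
    exact analyticAt_pi_iff.2 fun i => analyticAt_pi_iff.2 fun j =>
      matrix_adjugate_analyticAt (hP z hz) i j
  -- A null vector `v` of `W z` yields `E z (z • ι v)` in the kernel of the pencil, and `φ` maps
  -- that vector back to `v`.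
  · intro hinj hdet
    obtain ⟨v, hv, hv0⟩ := Matrix.exists_mulVec_eq_zero_iff.2 hdet
    rw [hPW] at hv0
    have hv1 : v = φ (E z (z • ι v)) := sub_eq_zero.1 hv0
    refine hv ?_
    have hx : E z (z • ι v) = 0 := by
      refine hinj ?_
      rw [map_zero, hDK]
      change ((u : X →L[ℂ] X) - z • S) (E z (z • ι v)) - z • ι (φ (E z (z • ι v))) = 0
      rw [← hv1, ← mul_apply_eq_comp, hDE, one_apply_eq_self, sub_self]
    rw [hv1, hx, map_zero]
  · intro hdet
    -- Cramer's rule keeps the adjugate analytic and confines all singularities to the scalar `(d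
    -- z)⁻¹`.
    have h1 : W z * ((P z).det⁻¹ • matrixCLM N (P z).adjugate) = 1 := by
      ext1 v
      change W z ((P z).det⁻¹ • ((P z).adjugate *ᵥ v)) = v
      rw [map_smul, ← hPW, Matrix.mulVec_mulVec, Matrix.mul_adjugate, Matrix.smul_mulVec,
        Matrix.one_mulVec, smul_smul, inv_mul_cancel₀ hdet, one_smul]
    have h2 : ((P z).det⁻¹ • matrixCLM N (P z).adjugate) * W z = 1 := by
      ext1 v
      change (P z).det⁻¹ • ((P z).adjugate *ᵥ (W z v)) = v
      rw [← hPW, Matrix.mulVec_mulVec, Matrix.adjugate_mul, Matrix.smul_mulVec,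
        Matrix.one_mulVec, smul_smul, inv_mul_cancel₀ hdet, one_smul]
    obtain ⟨k1, k2⟩ := mul_eq_one_of_comp hDE hED h1 h2
    rw [hDK]
    refine ⟨⟨⟨_, _, k1, k2⟩, rfl⟩, ?_⟩
    exact Ring.inverse_unit ⟨_, _, k1, k2⟩

/-- Analytic Fredholm theorem for the pencil `L - μ K` with `L` invertible and `K` a limit of
operators of finite rank. -/
theorem pencil_fredholm {L K : X →L[ℂ] X} (hL : IsUnit L)
    (hK : ∀ ε : ℝ, 0 < ε → ∃ F : X →L[ℂ] X,
      FiniteDimensional ℂ (LinearMap.range F.toLinearMap) ∧ ‖K - F‖ < ε) (z : ℂ) :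
    (∀ᶠ μ in 𝓝[≠] z, IsUnit (L - μ • K)) ∧
      HasFiniteRankPrincipalPart (fun μ => Ring.inverse (L - μ • K)) z ∧
      (Function.Injective (L - z • K) → IsUnit (L - z • K)) := by
  -- The ball must contain both `z` and the origin, where `d = 1` rules out a determinant that
  -- vanishes identically.
  obtain ⟨N, E, ι, φ, J, d, hd0, h⟩ := exists_det_of_approx hL hK (‖z‖ + 1)
  have hz : z ∈ Metric.ball (0 : ℂ) (‖z‖ + 1) := by simp
  have hball : ∀ᶠ μ in 𝓝[≠] z, μ ∈ Metric.ball (0 : ℂ) (‖z‖ + 1) :=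
    nhdsWithin_le_nhds (Metric.isOpen_ball.mem_nhds hz)
  obtain ⟨hE, hJ, hd, hinj, -⟩ := h z hz
  have hne : ∀ᶠ μ in 𝓝[≠] z, d μ ≠ 0 := by
    by_contra hcon
    have hfr : ∃ᶠ μ in 𝓝[≠] z, d μ = 0 := fun h' => hcon h'
    have := AnalyticOnNhd.eqOn_zero_of_preconnected_of_frequently_eq_zero
      (fun w hw => (h w hw).2.2.1) (convex_ball (0 : ℂ) (‖z‖ + 1)).isPreconnected hz hfr
      (Metric.mem_ball_self (by positivity))
    exact one_ne_zero (hd0.symm.trans this)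
  refine ⟨?_, ?_, fun hi => ((h z hz).2.2.2.2 (hinj hi)).1⟩
  · filter_upwards [hball, hne] with μ h1 h2 using ((h μ h1).2.2.2.2 h2).1
  -- Write `d = (μ - z) ^ p e` with `e z ≠ 0`; the factor `e⁻¹` is analytic and is absorbed into
  -- `c`.
  · obtain ⟨p, e, he, hez, hde⟩ := hd.exists_eventuallyEq_pow_smul_nonzero_iff.2 (by
      intro hev
      obtain ⟨μ, h1, h2⟩ := ((hev.filter_mono nhdsWithin_le_nhds).and hne).exists
      exact h2 h1)
    refine hasFiniteRankPrincipalPart_of_comp (V := Fin N → ℂ) (D := E)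
      (a := fun μ => E μ ∘L (μ • ι)) (c := fun μ => (e μ)⁻¹ • (J μ ∘L φ ∘L E μ)) p hE
      (analyticAt_clm_comp hE (analyticAt_id.smul analyticAt_const))
      ((he.inv hez).smul (analyticAt_clm_comp hJ (analyticAt_clm_comp analyticAt_const hE))) ?_
    filter_upwards [hball, hne, hde.filter_mono nhdsWithin_le_nhds] with μ h1 h2 h3
    rw [((h μ h1).2.2.2.2 h2).2, h3, smul_eq_mul, mul_inv]
    simp only [ContinuousLinearMap.smul_comp, ContinuousLinearMap.comp_smul, mul_smul,
      ContinuousLinearMap.comp_assoc]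

end Fredholm

/-! ### Finite-rank approximation and two auxiliary facts. -/

/-- An operator that maps the unit ball to functions with a common Lipschitz constant on a compact
space is a limit of operators of finite rank. -/
theorem exists_finiteRank_approx_of_lipschitz {X S E : Type*} [NormedAddCommGroup X]
    [NormedSpace ℂ X] [PseudoMetricSpace S] [CompactSpace S] [NormedAddCommGroup E]
    [NormedSpace ℂ E] [FiniteDimensional ℂ E] (T : X →L[ℂ] C(S, E)) {C : ℝ} (hC : 0 ≤ C)
    (hT : ∀ x t t', ‖T x t - T x t'‖ ≤ C * ‖x‖ * dist t t') {ε : ℝ} (hε : 0 < ε) :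
    ∃ F : X →L[ℂ] C(S, E),
      FiniteDimensional ℂ (LinearMap.range F.toLinearMap) ∧ ‖T - F‖ < ε := by
  set δ := ε / (C + 1)
  have hδ : 0 < δ := by positivity
  obtain ⟨t, -, htf, hcov⟩ := finite_cover_balls_of_compact
    (isCompact_univ (X := S)) hδ
  have := htf.fintype
  -- Hat functions of radius `δ`, normalized below to a partition of unity `p`. The approximant
  -- interpolates `T x` from its values at the finitely many centres.
  let w : t → S → ℝ := fun i s => max 0 (δ - dist s i)
  have hw0 : ∀ i s, 0 ≤ w i s := fun i s => le_max_left _ _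
  have hwc : ∀ i, Continuous (w i) := fun i => by fun_prop
  have hWpos : ∀ s, 0 < ∑ i, w i s := by
    intro s
    obtain ⟨i, hi, hs⟩ := Set.mem_iUnion₂.1 (hcov (Set.mem_univ s))
    refine Finset.sum_pos' (fun i _ => hw0 i s) ⟨⟨i, hi⟩, Finset.mem_univ _, ?_⟩
    exact lt_max_of_lt_right (sub_pos.2 hs)
  let p : t → S → ℝ := fun i s => w i s / ∑ j, w j s
  have hpc : ∀ i, Continuous (p i) := fun i =>
    (hwc i).div (continuous_finsetSum _ fun j _ => hwc j) fun s => (hWpos s).ne'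
  have hp0 : ∀ i s, 0 ≤ p i s := fun i s => div_nonneg (hw0 i s) (hWpos s).le
  have hp1 : ∀ s, ∑ i, p i s = 1 := fun s => by
    rw [← Finset.sum_div, div_self (hWpos s).ne']
  have hpd : ∀ i s, p i s * dist s i ≤ p i s * δ := by
    intro i s
    by_cases h : dist s i ≤ δ
    · exact mul_le_mul_of_nonneg_left h (hp0 i s)
    · have : p i s = 0 := by
        simp only [p, w, max_eq_left (sub_nonpos.2 (not_le.1 h).le), zero_div]
      simp [this]
  let I : (t → E) →ₗ[ℂ] C(S, E) :=
    { toFun := fun v => ⟨fun s => ∑ i, (p i s : ℂ) • v i, continuous_finsetSum _ fun i _ =>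
        (Complex.continuous_ofReal.comp (hpc i)).smul continuous_const⟩
      map_add' := fun v v' => by
        ext s
        simp [smul_add, Finset.sum_add_distrib]
      map_smul' := fun c v => by
        ext s
        simp [Finset.smul_sum, smul_comm c] }
  refine ⟨LinearMap.toContinuousLinearMap I ∘L
    ContinuousLinearMap.pi fun i : t => ContinuousMap.evalCLM ℂ (i : S) ∘L T,
    finiteDimensional_range_comp _ _, ?_⟩
  have hb : C * δ < ε := by
    have : (C + 1) * δ = ε := by simp only [δ]; field_simp
    nlinarith
  refine lt_of_le_of_lt (ContinuousLinearMap.opNorm_le_bound _ (by positivity) fun x => ?_) hb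
  refine (ContinuousMap.norm_le _ (by positivity)).2 fun s => ?_
  change ‖T x s - ∑ i : t, (p i s : ℂ) • T x i‖ ≤ _
  have e : T x s = ∑ i : t, (p i s : ℂ) • T x s := by
    rw [← Finset.sum_smul, ← Complex.ofReal_sum, hp1, Complex.ofReal_one, one_smul]
  rw [e, ← Finset.sum_sub_distrib]
  calc ‖∑ i : t, ((p i s : ℂ) • T x s - (p i s : ℂ) • T x i)‖
      ≤ ∑ i : t, ‖(p i s : ℂ) • T x s - (p i s : ℂ) • T x i‖ := norm_sum_le _ _
    _ ≤ ∑ i : t, p i s * (C * δ * ‖x‖) := by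
        refine Finset.sum_le_sum fun i _ => ?_
        rw [← smul_sub, norm_smul, Complex.norm_real, Real.norm_of_nonneg (hp0 i s)]
        calc p i s * ‖T x s - T x i‖ ≤ p i s * (C * ‖x‖ * dist s i) :=
              mul_le_mul_of_nonneg_left (hT x s i) (hp0 i s)
          _ = C * ‖x‖ * (p i s * dist s i) := by ring
          _ ≤ C * ‖x‖ * (p i s * δ) := mul_le_mul_of_nonneg_left (hpd i s) (by positivity)
          _ = _ := by ring
    _ = C * δ * ‖x‖ := by rw [← Finset.sum_mul, hp1, one_mul]

/-- `1 - a` is a factor of the unit `1 - a ^ m`, and commutes with the cofactor, a geometric sum. -/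
theorem isUnit_one_sub_of_norm_pow_lt_one {R : Type*} [NormedRing R] [CompleteSpace R] {a : R}
    {m : ℕ} (h : ‖a ^ m‖ < 1) : IsUnit (1 - a) := by
  have hu := isUnit_one_sub_of_norm_lt_one h
  rw [← mul_neg_geom_sum] at hu
  refine ((Commute.isUnit_mul_iff ?_).1 hu).1
  rw [Commute, SemiconjBy, mul_neg_geom_sum, geom_sum_mul_neg]

/-- A property that holds in a punctured neighbourhood of every point fails at finitely many points
of a bounded set only. -/
theorem finite_of_eventually_not {P : ℂ → Prop} (h : ∀ z, ∀ᶠ μ in 𝓝[≠] z, P μ) {S : Set ℂ}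
    (hS : Bornology.IsBounded S) : {μ ∈ S | ¬ P μ}.Finite := by
  have hc : IsCompact (closure S) := hS.isCompact_closure
  by_contra hinf
  -- Infinitely many exceptions would accumulate at some `z`, against the hypothesis there.
  obtain ⟨z, -, hz⟩ := Set.Infinite.exists_accPt_of_subset_isCompact hinf hc
    (fun μ hμ => subset_closure hμ.1)
  rw [accPt_iff_frequently_nhdsNE] at hz
  exact hz ((h z).mono fun μ hμ hμ' => hμ'.2 hμ)

end OperatorFunction

/-! ### The operators of the delay equation. -/

namespace PeriodicDDE

variable {n : ℕ} (A B : C(ℝ, Matrix (Fin n) (Fin n) ℂ)) (τ : ℝ)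

theorem rhs_affine (μ : ℂ) (x : Hist n) (s : ℝ) :
    rhs A B τ μ x s = rhs A B τ 0 x s + μ • (rhs A B τ 1 x s - rhs A B τ 0 x s) := by
  simp only [rhs, delayed]
  split_ifs
  · simp
  · simp [Matrix.mulVec_smul]

theorem M1_affine (μ : ℂ) : M1 A B τ μ = M1 A B τ 0 + μ • (M1 A B τ 1 - M1 A B τ 0) := by
  ext1 x
  ext1 t
  change (∫ s in (-1 : ℝ)..t, rhs A B τ μ x s) = (∫ s in (-1 : ℝ)..t, rhs A B τ 0 x s)
    + μ • ((∫ s in (-1 : ℝ)..t, rhs A B τ 1 x s) - ∫ s in (-1 : ℝ)..t, rhs A B τ 0 x s)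
  have i0 := rhs_intervalIntegrable A B τ 0 x (-1) t
  have i1 := rhs_intervalIntegrable A B τ 1 x (-1) t
  rw [← intervalIntegral.integral_sub i1 i0, ← intervalIntegral.integral_smul,
    ← intervalIntegral.integral_add i0 (g := fun s => μ • (rhs A B τ 1 x s - rhs A B τ 0 x s))
      ((i1.sub i0).smul μ)]
  exact intervalIntegral.integral_congr fun s _ => rhs_affine A B τ μ x s

theorem one_sub_M1_eq_pencil :
    (fun μ => 1 - M1 A B τ μ) = fun μ => (1 - M1 A B τ 0) - μ • (M1 A B τ 1 - M1 A B τ 0) := by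
  funext μ
  rw [M1_affine A B τ μ]
  abel

/-- The bound of the integrand is a Lipschitz constant of the integral. This is the source of the
compactness of `M1`. -/
theorem exists_M1_lipschitz (μ : ℂ) : ∃ C : ℝ, 0 ≤ C ∧
    ∀ (x : Hist n) (t t' : Set.Icc (-1 : ℝ) 0),
      ‖M1 A B τ μ x t - M1 A B τ μ x t'‖ ≤ C * ‖x‖ * dist t t' := by
  obtain ⟨K, hK0, hK⟩ := exists_rhs_bound A B τ μ
  refine ⟨K, hK0, fun x t t' => ?_⟩
  rw [M1_apply, M1_apply, intervalIntegral.integral_interval_sub_left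
    (rhs_intervalIntegrable A B τ μ x _ _) (rhs_intervalIntegrable A B τ μ x _ _),
    Subtype.dist_eq, Real.dist_eq]
  refine intervalIntegral.norm_integral_le_of_norm_le_const fun s hs => hK x s ?_
  exact Set.uIcc_subset_Icc t'.2 t.2 (Set.uIoc_subset_uIcc hs)

theorem exists_finiteRank_approx {ε : ℝ} (hε : 0 < ε) : ∃ F : Hist n →L[ℂ] Hist n,
    FiniteDimensional ℂ (LinearMap.range F.toLinearMap) ∧
      ‖(M1 A B τ 1 - M1 A B τ 0) - F‖ < ε := by
  obtain ⟨C, hC, h⟩ := exists_M1_lipschitz A B τ 0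
  obtain ⟨C', hC', h'⟩ := exists_M1_lipschitz A B τ 1
  refine OperatorFunction.exists_finiteRank_approx_of_lipschitz _ (add_nonneg hC hC')
    (fun x t t' => ?_) hε
  calc ‖(M1 A B τ 1 - M1 A B τ 0) x t - (M1 A B τ 1 - M1 A B τ 0) x t'‖
      = ‖(M1 A B τ 1 x t - M1 A B τ 1 x t') - (M1 A B τ 0 x t - M1 A B τ 0 x t')‖ := by
        congr 1
        change (M1 A B τ 1 x t - M1 A B τ 0 x t) - (M1 A B τ 1 x t' - M1 A B τ 0 x t') = _
        abel
    _ ≤ C' * ‖x‖ * dist t t' + C * ‖x‖ * dist t t' :=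
        (norm_sub_le _ _).trans (add_le_add (h' x t t') (h x t t'))
    _ = (C + C') * ‖x‖ * dist t t' := by ring

/-- For `μ = 0` the right-hand side at `s` depends on the history up to `s` only. -/
theorem exists_rhs_zero_bound (hτ0 : 0 ≤ τ) : ∃ K : ℝ, 0 ≤ K ∧
    ∀ (x : Hist n), ∀ s ∈ Set.Icc (-1 : ℝ) 0, ∀ b : ℝ, 0 ≤ b →
      (∀ u : Set.Icc (-1 : ℝ) 0, (u : ℝ) ≤ s → ‖x u‖ ≤ b) → ‖rhs A B τ 0 x s‖ ≤ K * b := by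
  obtain ⟨K, hK0, hK⟩ := exists_rhs_bound A B τ 0
  refine ⟨K, hK0, fun x s hs b hb h => ?_⟩
  -- Freezing the history after time `s` leaves the right-hand side at `s` unchanged and makes the
  -- norm at most `b`.
  let y : Hist n := x.comp ⟨fun u => min u ⟨s, hs⟩, by fun_prop⟩
  have hy : ‖y‖ ≤ b := (ContinuousMap.norm_le _ hb).2 fun u => h _ (min_le_right u ⟨s, hs⟩)
  have hxy : ∀ u ∈ Set.Icc (-1 : ℝ) 0, u ≤ s → ext y u = ext x u := by
    intro u hu hus
    simp only [ext]
    rw [Set.IccExtend_of_mem _ _ hu, Set.IccExtend_of_mem _ _ hu]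
    exact congrArg x (min_eq_left (show (⟨u, hu⟩ : Set.Icc (-1 : ℝ) 0) ≤ ⟨s, hs⟩ from hus))
  have e : rhs A B τ 0 x s = rhs A B τ 0 y s := by
    simp only [rhs, delayed]
    rw [hxy s hs le_rfl]
    split_ifs with hs'
    · rw [hxy (s - τ) ⟨by linarith, by linarith [hs.2]⟩ (by linarith)]
    -- For `s < τ - 1` the delayed value carries the factor `μ = 0`.
    · simp
  rw [e]
  exact (hK y s hs).trans (mul_le_mul_of_nonneg_left hy hK0)

/-- Volterra estimate: each application integrates the bound `(s + 1) ^ m` from `-1`, which produces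
the factorial. -/
theorem exists_norm_M1_zero_pow_le (hτ0 : 0 ≤ τ) : ∃ K : ℝ, 0 ≤ K ∧
    ∀ (m : ℕ) (x : Hist n) (t : Set.Icc (-1 : ℝ) 0),
      ‖(M1 A B τ 0 ^ m) x t‖ ≤ K ^ m / m.factorial * ‖x‖ * ((t : ℝ) + 1) ^ m := by
  obtain ⟨K, hK0, hK⟩ := exists_rhs_zero_bound A B τ hτ0
  refine ⟨K, hK0, fun m => ?_⟩
  induction m with
  | zero =>
    intro x t
    simpa using x.norm_coe_le_norm t
  | succ m ih =>
    intro x t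
    have ht := t.2
    rw [pow_succ', mul_apply_eq_comp, M1_apply]
    set c := K ^ m / m.factorial * ‖x‖
    have hc : 0 ≤ c := by positivity
    have hbound : ∀ s ∈ Set.Ioc (-1 : ℝ) t,
        ‖rhs A B τ 0 ((M1 A B τ 0 ^ m) x) s‖ ≤ K * (c * (s + 1) ^ m) := by
      intro s hs
      have hs1 : 0 ≤ s + 1 := by linarith [hs.1]
      refine hK _ s ⟨hs.1.le, hs.2.trans ht.2⟩ _ (by positivity) fun u hu => ?_
      refine (ih x u).trans (mul_le_mul_of_nonneg_left ?_ hc)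
      exact pow_le_pow_left₀ (by linarith [u.2.1]) (by linarith) m
    refine (intervalIntegral.norm_integral_le_of_norm_le ht.1
      (Filter.Eventually.of_forall hbound)
      (Continuous.intervalIntegrable (by fun_prop) _ _)).trans_eq ?_
    rw [intervalIntegral.integral_const_mul, intervalIntegral.integral_const_mul,
      intervalIntegral.integral_comp_add_right (fun s : ℝ => s ^ m), integral_pow,
      Nat.factorial_succ]
    simp only [c, neg_add_cancel, ne_eq, Nat.succ_ne_zero, not_false_eq_true, zero_pow, sub_zero]
    push_cast
    field_simp
    ring

theorem isUnit_one_sub_M1_zero (hτ0 : 0 ≤ τ) : IsUnit (1 - M1 A B τ 0) := by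
  obtain ⟨K, hK0, hK⟩ := exists_norm_M1_zero_pow_le A B τ hτ0
  obtain ⟨m, hm⟩ := ((FloorSemiring.tendsto_pow_div_factorial_atTop K).eventually_lt_const
    one_pos).exists
  refine OperatorFunction.isUnit_one_sub_of_norm_pow_lt_one (a := M1 A B τ 0) (m := m) (lt_of_le_of_lt ?_ hm)
  refine ContinuousLinearMap.opNorm_le_bound _ (by positivity) fun x => ?_
  refine (ContinuousMap.norm_le _ (by positivity)).2 fun t => (hK m x t).trans ?_
  refine mul_le_of_le_one_right (by positivity) (pow_le_one₀ ?_ ?_)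
  · linarith [t.2.1]
  · linarith [t.2.2]

theorem fredholm (hτ0 : 0 ≤ τ) (z : ℂ) :
    (∀ᶠ μ in 𝓝[≠] z, IsUnit (1 - M1 A B τ μ)) ∧
      OperatorFunction.HasFiniteRankPrincipalPart (resolvent A B τ) z ∧
      (Function.Injective ⇑(1 - M1 A B τ z : Hist n →L[ℂ] Hist n) → IsUnit (1 - M1 A B τ z)) := by
  have h := OperatorFunction.pencil_fredholm (isUnit_one_sub_M1_zero A B τ hτ0)
    (fun ε hε => exists_finiteRank_approx A B τ hε) z
  have e : ∀ μ, (1 - M1 A B τ 0) - μ • (M1 A B τ 1 - M1 A B τ 0) = 1 - M1 A B τ μ :=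
    fun μ => (congrFun (one_sub_M1_eq_pencil A B τ) μ).symm
  simp only [e] at h
  exact h

theorem analyticAt_one_sub_M1 (z : ℂ) : AnalyticAt ℂ (fun μ => 1 - M1 A B τ μ) z := by
  rw [one_sub_M1_eq_pencil]
  exact OperatorFunction.analyticAt_pencil _ _ z

theorem analyticAt_resolvent {z : ℂ} (h : IsUnit (1 - M1 A B τ z)) :
    AnalyticAt ℂ (resolvent A B τ) z :=
  OperatorFunction.analyticAt_ringInverse (H := fun μ => 1 - M1 A B τ μ)
    (analyticAt_one_sub_M1 A B τ z) h

theorem isPole_resolvent_iff (hτ0 : 0 ≤ τ) (z : ℂ) :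
    OperatorFunction.IsPole (resolvent A B τ) z ↔ ¬ IsUnit (1 - M1 A B τ z) := by
  obtain ⟨hu, hp, -⟩ := fredholm A B τ hτ0 z
  exact OperatorFunction.isPole_ringInverse_iff (H := fun μ => 1 - M1 A B τ μ) (analyticAt_one_sub_M1 A B τ z) hu
    hp.meromorphicAt

theorem algebraicMultiplicity_lt_top (hτ0 : 0 ≤ τ) (z : ℂ) :
    OperatorFunction.algebraicMultiplicity (fun μ => 1 - M1 A B τ μ) z < ⊤ := by
  obtain ⟨hu, hp, -⟩ := fredholm A B τ hτ0 z
  have e := one_sub_M1_eq_pencil A B τ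
  rw [e]
  refine OperatorFunction.algebraicMultiplicity_pencil_lt_top ?_ ?_
  · exact hu.mono fun μ hμ => by rwa [← congrFun e μ]
  · simp only [← congrFun e]
    exact hp

/-! ### The initial-value problem and the characteristic matrix. -/

variable {A B τ}

theorem isSolution_iff {μ : ℂ} {v : Fin n → ℂ} {x : Hist n} :
    IsSolution A B τ μ v x ↔ (1 - M1 A B τ μ) x = ContinuousMap.const _ v := by
  rw [ContinuousMap.ext_iff]
  exact forall_congr' fun t => sub_eq_iff_eq_add.symm

theorem IsSolution.eq_resolvent {μ : ℂ} (h : IsUnit (1 - M1 A B τ μ)) {v : Fin n → ℂ} {x : Hist n}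
    (hx : IsSolution A B τ μ v x) : x = resolvent A B τ μ (ContinuousMap.const _ v) := by
  rw [← isSolution_iff.1 hx, resolvent, ← mul_apply_eq_comp, Ring.inverse_mul_cancel _ h,
    one_apply_eq_self]

theorem isSolution_resolvent {μ : ℂ} (h : IsUnit (1 - M1 A B τ μ)) (v : Fin n → ℂ) :
    IsSolution A B τ μ v (resolvent A B τ μ (ContinuousMap.const _ v)) := by
  rw [isSolution_iff, resolvent, ← mul_apply_eq_comp, Ring.mul_inverse_cancel _ h,
    one_apply_eq_self]

/-- Uniqueness for `v = 0` alone makes `1 - M1 A B τ μ` injective, and the Fredholm alternative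
turns this into invertibility. -/
theorem uniquelySolvable_iff (hτ0 : 0 ≤ τ) {μ : ℂ} :
    UniquelySolvable A B τ μ ↔ IsUnit (1 - M1 A B τ μ) := by
  refine ⟨fun h => (fredholm A B τ hτ0 μ).2.2 ?_, fun h v =>
    ⟨_, isSolution_resolvent h v, fun y hy => hy.eq_resolvent h⟩⟩
  refine (injective_iff_map_eq_zero _).2 fun x hx => (h 0).unique ?_ ?_
  · rw [isSolution_iff, hx]
    rfl
  · rw [isSolution_iff, map_zero]
    rfl

theorem charMatrix_apply {μ : ℂ} (h : UniquelySolvable A B τ μ) {v : Fin n → ℂ} {x : Hist n}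
    (hx : IsSolution A B τ μ v x) : charMatrix A B τ μ v = v - μ • x rightEnd := by
  rw [(h v).unique hx (h v).choose_spec.1, charMatrix, dif_pos h]
  rfl

variable (A B τ) in
/-- The expression `I - μ ev₀ [I - M₁(μ)]⁻¹ const` of the characteristic matrix through the
resolvent. -/
noncomputable def resolventMatrix (μ : ℂ) : (Fin n → ℂ) →L[ℂ] (Fin n → ℂ) :=
  1 - μ • (ContinuousMap.evalCLM ℂ rightEnd ∘L resolvent A B τ μ ∘L
    ContinuousLinearMap.const ℂ (Set.Icc (-1 : ℝ) 0))

theorem charMatrix_eq_resolventMatrix (hτ0 : 0 ≤ τ) {μ : ℂ} (h : IsUnit (1 - M1 A B τ μ)) :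
    charMatrix A B τ μ = resolventMatrix A B τ μ := by
  ext1 v
  rw [charMatrix_apply ((uniquelySolvable_iff hτ0).2 h) (isSolution_resolvent h v)]
  rfl

theorem analyticAt_charMatrix (hτ0 : 0 ≤ τ) {μ : ℂ} (h : IsUnit (1 - M1 A B τ μ)) :
    AnalyticAt ℂ (charMatrix A B τ) μ := by
  have hH := analyticAt_one_sub_M1 A B τ μ
  have hR := analyticAt_resolvent A B τ h
  have hM : AnalyticAt ℂ (resolventMatrix A B τ) μ :=
    analyticAt_const.sub (analyticAt_id.smul (OperatorFunction.analyticAt_clm_comp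
      analyticAt_const (OperatorFunction.analyticAt_clm_comp hR analyticAt_const)))
  refine hM.congr ?_
  -- Units form an open set, so the resolvent formula holds in a full neighbourhood of `μ`.
  filter_upwards [hH.continuousAt.preimage_mem_nhds
    ((Units.isOpen (R := Hist n →L[ℂ] Hist n)).mem_nhds h)] with z hz
  exact (charMatrix_eq_resolventMatrix hτ0 hz).symm

theorem meromorphicAt_charMatrix (hτ0 : 0 ≤ τ) (z : ℂ) :
    MeromorphicAt (charMatrix A B τ) z := by
  obtain ⟨hu, hp, -⟩ := fredholm A B τ hτ0 z
  obtain ⟨p, hp⟩ := hp.meromorphicAt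
  have hM : MeromorphicAt (resolventMatrix A B τ) z := by
    -- The power of `μ - z` that clears the pole of the resolvent also clears it after composition
    -- with fixed operators.
    refine (MeromorphicAt.const 1 z).fun_sub (analyticAt_id.meromorphicAt.fun_smul ⟨p, ?_⟩)
    have := OperatorFunction.analyticAt_clm_comp
      (analyticAt_const (v := (ContinuousMap.evalCLM ℂ rightEnd : Hist n →L[ℂ] (Fin n → ℂ))) (x := z))
      (OperatorFunction.analyticAt_clm_comp hp (analyticAt_const
        (v := (ContinuousLinearMap.const ℂ (Set.Icc (-1 : ℝ) 0) : (Fin n → ℂ) →L[ℂ] Hist n))))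
    simpa only [ContinuousLinearMap.smul_comp, ContinuousLinearMap.comp_smul] using this
  exact hM.congr (hu.mono fun μ hμ => (charMatrix_eq_resolventMatrix hτ0 hμ).symm)

end PeriodicDDE

theorem lemma2p3 (n : ℕ) (A B : C(ℝ, Matrix (Fin n) (Fin n) ℂ))
    (hA : Function.Periodic A 1) (hB : Function.Periodic B 1)
    (τ : ℝ) (hτ0 : 0 ≤ τ) (hτ1 : τ < 1) :
    -- the operator-valued function `R(μ) = [I - M₁(μ)]⁻¹`
    (∀ S : Set ℂ, Bornology.IsBounded S →
      {μ ∈ S | OperatorFunction.IsPole (PeriodicDDE.resolvent A B τ) μ}.Finite) ∧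
    (∀ μ : ℂ, OperatorFunction.IsPole (PeriodicDDE.resolvent A B τ) μ →
      OperatorFunction.HasFiniteRankPrincipalPart (PeriodicDDE.resolvent A B τ) μ ∧
      OperatorFunction.algebraicMultiplicity (fun z => 1 - PeriodicDDE.M1 A B τ z) μ < ⊤) ∧
    (∀ μ : ℂ, ¬ OperatorFunction.IsPole (PeriodicDDE.resolvent A B τ) μ →
      IsUnit (1 - PeriodicDDE.M1 A B τ μ) ∧ AnalyticAt ℂ (PeriodicDDE.resolvent A B τ) μ) ∧
    -- the characteristic matrix `Δ(μ)`
    (∀ S : Set ℂ, Bornology.IsBounded S →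
      {μ ∈ S | OperatorFunction.IsPole (PeriodicDDE.charMatrix A B τ) μ}.Finite) ∧
    (∀ μ : ℂ, OperatorFunction.IsPole (PeriodicDDE.charMatrix A B τ) μ →
      OperatorFunction.IsPole (PeriodicDDE.resolvent A B τ) μ ∧
      OperatorFunction.HasFiniteRankPrincipalPart (PeriodicDDE.charMatrix A B τ) μ) ∧
    (∀ μ : ℂ, PeriodicDDE.UniquelySolvable A B τ μ ↔
      ¬ OperatorFunction.IsPole (PeriodicDDE.resolvent A B τ) μ) ∧
    (∀ μ : ℂ, PeriodicDDE.UniquelySolvable A B τ μ →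
      AnalyticAt ℂ (PeriodicDDE.charMatrix A B τ) μ ∧
      ∀ (v : Fin n → ℂ) (x : PeriodicDDE.Hist n), PeriodicDDE.IsSolution A B τ μ v x →
        x = PeriodicDDE.resolvent A B τ μ (ContinuousMap.const _ v) ∧
        PeriodicDDE.charMatrix A B τ μ v = v - μ • x PeriodicDDE.rightEnd) ∧
    (∀ μ : ℂ, ¬ OperatorFunction.IsPole (PeriodicDDE.charMatrix A B τ) μ →
      ∃ G : ℂ → (Fin n → ℂ) →L[ℂ] (Fin n → ℂ), AnalyticAt ℂ G μ ∧
        ∀ᶠ z in nhdsWithin μ {μ}ᶜ, PeriodicDDE.charMatrix A B τ z = G z) := by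

  have hpole := PeriodicDDE.isPole_resolvent_iff A B τ hτ0
  have hunit : ∀ μ, ¬ OperatorFunction.IsPole (PeriodicDDE.resolvent A B τ) μ →
      IsUnit (1 - PeriodicDDE.M1 A B τ μ) := fun μ h => not_not.1 fun h' => h ((hpole μ).2 h')
  have hsub : ∀ μ, OperatorFunction.IsPole (PeriodicDDE.charMatrix A B τ) μ →
      OperatorFunction.IsPole (PeriodicDDE.resolvent A B τ) μ := fun μ h => by
    by_contra h'
    exact OperatorFunction.not_isPole_of_analyticAt
      (PeriodicDDE.analyticAt_charMatrix hτ0 (hunit μ h')) h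
  have hfin : ∀ S : Set ℂ, Bornology.IsBounded S →
      {μ ∈ S | OperatorFunction.IsPole (PeriodicDDE.resolvent A B τ) μ}.Finite := fun S hS => by
    simp only [hpole]
    -- Poles are the points of non-invertibility, and near every point the operator is invertible
    -- off that point.
    exact OperatorFunction.finite_of_eventually_not
      (fun z => (PeriodicDDE.fredholm A B τ hτ0 z).1) hS
  refine ⟨hfin, fun μ _ => ⟨(PeriodicDDE.fredholm A B τ hτ0 μ).2.1,
    PeriodicDDE.algebraicMultiplicity_lt_top A B τ hτ0 μ⟩, fun μ h => ⟨hunit μ h, ?_⟩,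
    fun S hS => (hfin S hS).subset fun μ hμ => ⟨hμ.1, hsub μ hμ.2⟩, fun μ h => ⟨hsub μ h, ?_⟩,
    fun μ => ?_, fun μ h => ?_, fun μ h => ?_⟩
  · exact PeriodicDDE.analyticAt_resolvent A B τ (hunit μ h)
  · exact OperatorFunction.hasFiniteRankPrincipalPart_of_meromorphicAt
      (PeriodicDDE.meromorphicAt_charMatrix hτ0 μ)
  · rw [PeriodicDDE.uniquelySolvable_iff hτ0, hpole, not_not]
  · have hu := (PeriodicDDE.uniquelySolvable_iff hτ0).1 h
    exact ⟨PeriodicDDE.analyticAt_charMatrix hτ0 hu, fun v x hx =>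
      ⟨hx.eq_resolvent hu, PeriodicDDE.charMatrix_apply h hx⟩⟩
  · exact OperatorFunction.exists_analyticAt_of_not_isPole
      (PeriodicDDE.meromorphicAt_charMatrix hτ0 μ) h
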